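/- Let $w$ be a finite word whose letters are vertices of a graph $G$. Two distinct letters $i,j$ \emph{alternate} in $w$ if the word obtained from $w$ by deleting all letters other than $i$ and $j$ contains neither $ii$ nor $jj$ as a block of consecutive letters. The graph $G$ is \emph{word-representable} if there is a word $w$ over $V(G)$ such that any two distinct vertices $i,j$ are adjacent in $G$ if and only if they alternate in $w$. The graph $G$ is \emph{minimal non-word-representable} if it is not word-representable but each of its proper induced subgraphs is. For $n\ge 3$ let $G_n^4$ be the graph with the $2n+3$ vertices $1,2,\dots,2n+1,x,y$ and the following edges: $\{i,i+1\}$ for $2\le i\le 2n-1$; $\{1,j\}$ for $2\le j\le 2n+1$; $\{2n+1,j\}$ for $2\le j\le 2n$; $\{x,1\}$, $\{x,2n\}$, $\{y,2\}$ and $\{y,2n+1\}$. **Theorem.** For every $n\ge 3$ the graph $G_n^4$ is minimal non-word-representable, and for distinct $m,n\ge 3$ the graphs $G_m^4$ and $G_n^4$ are not isomorphic. Thus the graphs $G_n^4$, $n\ge 3$, form an infinite class of minimal non-word-representable graphs. -/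

import Mathlib

/-- Two letters `i` and `j` alternate in the word `w` if the restriction of `w` to the copies of
`i` and `j` contains neither `ii` nor `jj` as a block of consecutive letters. -/
def Alternate {V : Type*} [DecidableEq V] (w : List V) (i j : V) : Prop :=
  ¬ [i, i] <:+: w.filter (fun k => decide (k = i ∨ k = j)) ∧
    ¬ [j, j] <:+: w.filter (fun k => decide (k = i ∨ k = j))

/-- The word `w` over the vertex set of `G` represents `G`. -/
def Represents {V : Type*} [DecidableEq V] (w : List V) (G : SimpleGraph V) : Prop :=
  ∀ i j : V, i ≠ j → (G.Adj i j ↔ Alternate w i j)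

/-- A graph is word-representable if some word over its vertex set represents it. -/
def WordRepresentable {V : Type*} [DecidableEq V] (G : SimpleGraph V) : Prop :=
  ∃ w : List V, Represents w G

/-- A graph is minimal non-word-representable if it is not word-representable, but every proper
induced subgraph of it is. -/
def MinimalNonWordRepresentable {V : Type*} [DecidableEq V] (G : SimpleGraph V) : Prop :=
  ¬ WordRepresentable G ∧ ∀ s : Set V, s ≠ Set.univ → WordRepresentable (G.induce s)

/-- The vertices of `G_n^4`: the numbers `1, …, 2n+1` and two further vertices `x` and `y`. -/
inductive G4Vertex (n : ℕ) : Type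
  | num (i : ℕ) (one_le : 1 ≤ i) (le : i ≤ 2 * n + 1) : G4Vertex n
  | x : G4Vertex n
  | y : G4Vertex n
  deriving DecidableEq

/-- The edges of `G_n^4`, each listed in one direction. -/
def G4Rel (n : ℕ) : G4Vertex n → G4Vertex n → Prop
  | .num i _ _, .num j _ _ =>
      -- the path `2, 3, …, 2n`
      (2 ≤ i ∧ j = i + 1 ∧ j ≤ 2 * n) ∨
      -- the vertex `1` is joined to `2, …, 2n+1`
      (i = 1 ∧ 2 ≤ j) ∨
      -- the vertex `2n+1` is joined to `2, …, 2n`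
      (i = 2 * n + 1 ∧ 2 ≤ j ∧ j ≤ 2 * n)
  | .x, .num j _ _ => j = 1 ∨ j = 2 * n
  | .y, .num j _ _ => j = 2 ∨ j = 2 * n + 1
  | _, _ => False

/-- The graph `G_n^4`. -/
def G4 (n : ℕ) : SimpleGraph (G4Vertex n) := SimpleGraph.fromRel (G4Rel n)

/-! Count the occurrences of each letter in the prefixes of a representing word. Adjacency of two
letters then means that one count function lies between the other and the other plus one (`Close`).
Let `a`, `b` belong to the vertices 1 and 2n+1; up to a change of sign, b ≤ a ≤ b+1. Each path
vertex 2, …, 2n is close to both, so its function lies either between b and a or outside. Functions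
of different kinds are always close and the complement of the path is connected, so all are of one
kind. Within a kind, after a shift of some outer functions, closeness is comparability; hence the
steps of the path go up and down alternately. The vertices y and x fix the directions of the first
and last step (`not_le_of_between`, `IsOuter.not_le`), against the parity of the path
(`le_last_of_zigzag`).

Without any one vertex the graph has a transitive orientation, and a concatenation of suitable
linear extensions represents it (`wordRepresentable_of_rank`). The numbers of vertices rule out
isomorphisms. -/

/-! ### Alternation in terms of prefix counts -/

/-- Before each point of `w`, the letter `i` has occurred as often as `j`, or once more. -/
def Leads {V : Type*} [DecidableEq V] (w : List V) (i j : V) : Prop :=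
  ∀ t : ℕ, (w.take t).count j ≤ (w.take t).count i ∧ (w.take t).count i ≤ (w.take t).count j + 1

/-- The prepended `j` forces the first surviving letter to be `i`; reading that `i` exchanges the
two roles. -/
theorem leads_iff_isChain {V : Type*} [DecidableEq V] (w : List V) {i j : V} (hij : i ≠ j) :
    Leads w i j ↔ (j :: w.filter (fun k => decide (k = i ∨ k = j))).IsChain (· ≠ ·) := by
  induction w generalizing i j with
  | nil => simp [Leads]
  | cons a w ih =>
    by_cases hi : a = i
    · subst hi
      have key : Leads (a :: w) a j ↔ Leads w j a := by
        refine ⟨fun h t => ?_, fun h t => ?_⟩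
        · have := h (t + 1)
          simp [hij] at this
          omega
        · cases t with
          | zero => simp
          | succ t =>
            have := h t
            simp [hij]
            omega
      have : (fun k => decide (k = j ∨ k = a)) = (fun k => decide (k = a ∨ k = j)) := by
        funext k; simp [or_comm]
      rw [key, ih hij.symm, this]
      simp [hij.symm]
    · by_cases hj : a = j
      · subst hj
        refine iff_of_false (fun h => ?_) (by simp)
        have := h 1
        simp [Ne.symm hij] at this
      · have key : Leads (a :: w) i j ↔ Leads w i j := by
          refine ⟨fun h t => ?_, fun h t => ?_⟩
          · have := h (t + 1)
            simpa [hi, hj] using this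
          · cases t with
            | zero => simp
            | succ t => simpa [hi, hj] using h t
        rw [key, ih hij]
        simp [hi, hj]

theorem isChain_ne_iff_not_infix {V : Type*} (l : List V) :
    l.IsChain (· ≠ ·) ↔ ∀ k, ¬ [k, k] <:+: l := by
  induction l with
  | nil => simp
  | cons a l ih =>
    cases l with
    | nil => simp [List.infix_cons_iff]
    | cons b l =>
      rw [List.isChain_cons_cons, ih]
      constructor
      · rintro ⟨hab, h⟩ k hk
        rcases List.infix_cons_iff.1 hk with hk | hk
        · simp only [List.cons_prefix_cons] at hk
          exact hab (hk.1.symm.trans hk.2.1)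
        · exact h k hk
      · intro h
        refine ⟨?_, fun k hk => h k (List.infix_cons_iff.2 (Or.inr hk))⟩
        rintro rfl
        exact h a (List.infix_cons_iff.2 (Or.inl (by simp)))

theorem alternate_iff_leads {V : Type*} [DecidableEq V] (w : List V) {i j : V} (hij : i ≠ j) :
    Alternate w i j ↔ Leads w i j ∨ Leads w j i := by
  have hswap : (fun k => decide (k = j ∨ k = i)) = (fun k => decide (k = i ∨ k = j)) := by
    funext k; simp [or_comm]
  rw [leads_iff_isChain w hij, leads_iff_isChain w hij.symm, hswap]
  have halt : Alternate w i j ↔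
      (w.filter (fun k => decide (k = i ∨ k = j))).IsChain (· ≠ ·) := by
    rw [isChain_ne_iff_not_infix, Alternate]
    refine ⟨fun h k hk => ?_, fun h => ⟨h i, h j⟩⟩
    have hm : k ∈ w.filter (fun k => decide (k = i ∨ k = j)) := hk.subset (by simp)
    rw [List.mem_filter] at hm
    rcases of_decide_eq_true hm.2 with rfl | rfl
    · exact h.1 hk
    · exact h.2 hk
  rw [halt]
  rcases w.filter (fun k => decide (k = i ∨ k = j)) with _ | ⟨a, l⟩
  · simp
  · simp only [List.isChain_cons_cons]
    by_cases h : a = i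
    · subst h; simp [hij.symm]
    · simp [Ne.symm h]

/-! ### Words made of permutations, and transitive orientations -/

/-- The letters of a finite type, sorted by a key. -/
noncomputable def sortedBy {V : Type*} [Fintype V] (κ : V → ℕ) : List V :=
  (Finset.univ : Finset V).toList.insertionSort (fun u v => κ u ≤ κ v)

theorem sortedBy_perm {V : Type*} [Fintype V] (κ : V → ℕ) :
    (sortedBy κ).Perm (Finset.univ : Finset V).toList :=
  List.perm_insertionSort _ _

theorem sortedBy_pairwise {V : Type*} [Fintype V] (κ : V → ℕ) :
    (sortedBy κ).Pairwise (fun u v => κ u ≤ κ v) :=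
  haveI : Std.Total (fun u v : V => κ u ≤ κ v) := ⟨fun u v => le_total (κ u) (κ v)⟩
  haveI : IsTrans V (fun u v : V => κ u ≤ κ v) := ⟨fun _ _ _ h h' => le_trans h h'⟩
  List.pairwise_insertionSort _ _

theorem count_sortedBy {V : Type*} [Fintype V] [DecidableEq V] (κ : V → ℕ) (v : V) :
    (sortedBy κ).count v = 1 := by
  rw [(sortedBy_perm κ).count_eq]
  exact List.count_eq_one_of_mem (Finset.nodup_toList _) (by simp)

theorem leads_sortedBy {V : Type*} [Fintype V] [DecidableEq V] {κ : V → ℕ} {i j : V}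
    (h : κ i < κ j) : Leads (sortedBy κ) i j := by
  intro t
  have hi := count_sortedBy κ i
  have hj := count_sortedBy κ j
  have hs := sortedBy_pairwise κ
  rw [← List.take_append_drop t (sortedBy κ)] at hi hj hs
  rw [List.count_append] at hi hj
  rw [List.pairwise_append] at hs
  have : ¬ (0 < (List.take t (sortedBy κ)).count j ∧
      0 < (List.drop t (sortedBy κ)).count i) := by
    rintro ⟨h1, h2⟩
    have := hs.2.2 j (List.count_pos_iff.1 h1) i (List.count_pos_iff.1 h2)
    omega
  omega

theorem leads_append {V : Type*} [DecidableEq V] {u w : List V} {i j : V}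
    (hu : Leads u i j) (hc : u.count i = u.count j) (hw : Leads w i j) : Leads (u ++ w) i j := by
  intro t
  rw [List.take_append]
  simp only [List.count_append]
  rcases le_or_gt t u.length with h | h
  · have := hu t
    simpa [Nat.sub_eq_zero_of_le h] using this
  · have := hw (t - u.length)
    rw [List.take_of_length_le h.le]
    omega

theorem leads_of_leads_append_right {V : Type*} [DecidableEq V] {u w : List V} {i j : V}
    (hc : u.count i = u.count j) (h : Leads (u ++ w) i j) : Leads w i j := by
  intro t
  have := h (u.length + t)
  simp only [List.take_length_add_append, List.count_append] at this
  omega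

theorem leads_of_leads_append_left {V : Type*} [DecidableEq V] {u w : List V} {i j : V}
    (h : Leads (u ++ w) i j) : Leads u i j := by
  intro t
  rcases le_or_gt t u.length with ht | ht
  · have := h t
    rwa [List.take_append_of_le_length ht] at this
  · have := h u.length
    rw [List.take_left' rfl] at this
    rwa [List.take_of_length_le ht.le]

theorem count_flatMap_sortedBy {V ι : Type*} [Fintype V] [DecidableEq V] (κ : ι → V → ℕ)
    (l : List ι) (v : V) : (l.flatMap (fun k => sortedBy (κ k))).count v = l.length := by
  induction l with
  | nil => simp
  | cons a l ih => simp [ih, count_sortedBy, add_comm]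

theorem leads_flatMap_sortedBy {V ι : Type*} [Fintype V] [DecidableEq V] (κ : ι → V → ℕ)
    (l : List ι) {i j : V} (h : ∀ k, κ k i < κ k j) :
    Leads (l.flatMap (fun k => sortedBy (κ k))) i j := by
  induction l with
  | nil => simp [Leads]
  | cons a l ih =>
    rw [List.flatMap_cons]
    exact leads_append (leads_sortedBy (h a)) (by simp [count_sortedBy]) ih

theorem leads_antisymm_of_mem {V : Type*} [DecidableEq V] {w : List V} {i j : V} (hij : i ≠ j)
    (h : Leads w i j) (h' : Leads w j i) : i ∉ w := by
  intro hm
  obtain ⟨u, v, rfl⟩ := List.append_of_mem hm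
  have h1 := h u.length
  have h2 := h' u.length
  have h3 := h (u.length + 1)
  have h4 := h' (u.length + 1)
  rw [List.take_length_add_append] at h3 h4
  simp [hij] at h1 h2 h3 h4
  omega

/-- The blocks before block `k` contain `i` and `j` equally often, so a wrong order inside block `k`
is visible in the whole word. -/
theorem not_leads_flatMap_sortedBy {V ι : Type*} [Fintype V] [DecidableEq V] (κ : ι → V → ℕ)
    {l : List ι} {i j : V} {k : ι} (hk : k ∈ l) (h : κ k i < κ k j) :
    ¬ Leads (l.flatMap (fun k => sortedBy (κ k))) j i := by
  obtain ⟨l₁, l₂, rfl⟩ := List.append_of_mem hk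
  intro hl
  rw [List.flatMap_append, List.flatMap_cons] at hl
  have h1 := leads_of_leads_append_left
    (leads_of_leads_append_right (by simp [count_flatMap_sortedBy]) hl)
  refine leads_antisymm_of_mem (fun e => ?_) (leads_sortedBy h) h1
    ((sortedBy_perm _).mem_iff.2 (by simp))
  subst e
  exact lt_irrefl _ h

theorem wordRepresentable_of_keys {V ι : Type*} [Finite V] [Finite ι] [DecidableEq V]
    (G : SimpleGraph V) (κ : ι → V → ℕ)
    (hadj : ∀ i j, G.Adj i j → (∀ k, κ k i < κ k j) ∨ (∀ k, κ k j < κ k i))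
    (hnadj : ∀ i j, i ≠ j → ¬ G.Adj i j → ∃ k, κ k i < κ k j) : WordRepresentable G := by
  classical
  have := Fintype.ofFinite V
  have := Fintype.ofFinite ι
  refine ⟨(Finset.univ : Finset ι).toList.flatMap (fun k => sortedBy (κ k)), fun i j hij => ?_⟩
  rw [alternate_iff_leads _ hij]
  constructor
  · intro h
    exact (hadj i j h).imp (leads_flatMap_sortedBy κ _) (leads_flatMap_sortedBy κ _)
  · intro h
    by_contra hn
    obtain ⟨k, hk⟩ := hnadj i j hij hn
    obtain ⟨k', hk'⟩ := hnadj j i hij.symm (fun h => hn h.symm)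
    exact h.elim (not_leads_flatMap_sortedBy κ (by simp) hk')
      (not_leads_flatMap_sortedBy κ (by simp) hk)

/-- A graph with a transitive orientation, given by increasing ranks, is word-representable. -/
theorem wordRepresentable_of_rank {V : Type*} [Finite V] [DecidableEq V]
    (G : SimpleGraph V) (r : V → ℕ) (hr : ∀ u v, G.Adj u v → r u ≠ r v)
    (htrans : ∀ u v w, G.Adj u v → G.Adj v w → r u < r v → r v < r w → G.Adj u w) :
    WordRepresentable G := by
  classical
  obtain ⟨N, hN⟩ : ∃ N, ∀ v, r v < N := by
    obtain ⟨N, hN⟩ := (Set.finite_range r).bddAbove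
    exact ⟨N + 1, fun v => Nat.lt_succ_of_le (hN ⟨v, rfl⟩)⟩
  -- The permutation for `k` puts `k` and its predecessors before everything else. By transitivity
  -- these form a down-set, so the order stays a linear extension.
  have hmono : ∀ u v k, G.Adj u v → r u < r v →
      r u + (if u = k ∨ (G.Adj u k ∧ r u < r k) then 0 else N) <
        r v + (if v = k ∨ (G.Adj v k ∧ r v < r k) then 0 else N) := by
    intro u v k huv hlt
    by_cases hv : v = k ∨ (G.Adj v k ∧ r v < r k)
    · have hu : u = k ∨ (G.Adj u k ∧ r u < r k) := by
        rcases hv with rfl | ⟨h1, h2⟩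
        · exact Or.inr ⟨huv, hlt⟩
        · exact Or.inr ⟨htrans u v k huv h1 hlt h2, hlt.trans h2⟩
      rw [if_pos hv, if_pos hu]
      omega
    · rw [if_neg hv]
      split_ifs <;> omega
  refine wordRepresentable_of_keys G
    (fun k v => r v + (if v = k ∨ (G.Adj v k ∧ r v < r k) then 0 else N)) ?_ ?_
  · intro i j h
    rcases lt_or_gt_of_ne (hr i j h) with hlt | hlt
    · exact Or.inl fun k => hmono i j k h hlt
    · exact Or.inr fun k => hmono j i k h.symm hlt
  · intro i j hij hn
    refine ⟨i, ?_⟩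
    have : ¬ (j = i ∨ (G.Adj j i ∧ r j < r i)) := by
      rintro (h | h)
      · exact hij h.symm
      · exact hn h.1.symm
    simp only [true_or, if_true, if_neg this]
    have := hN i
    omega

theorem wordRepresentable_induce_of_rank {V : Type*} [Finite V] [DecidableEq V]
    (G : SimpleGraph V) (v : V) (r : V → ℕ)
    (hr : ∀ i j, i ≠ v → j ≠ v → G.Adj i j → r i ≠ r j)
    (htrans : ∀ i j k, i ≠ v → j ≠ v → k ≠ v → G.Adj i j → G.Adj j k → r i < r j → r j < r k →
      G.Adj i k) {s : Set V} (hv : v ∉ s) : WordRepresentable (G.induce s) := by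
  have hne : ∀ i : s, (i : V) ≠ v := fun i h => hv (h ▸ i.2)
  exact wordRepresentable_of_rank _ (fun i : s => r i)
    (fun i j h => hr i j (hne i) (hne j) h)
    (fun i j k h h' => htrans i j k (hne i) (hne j) (hne k) h h')

/-! ### Vertices and adjacency of the graph -/

/-- The vertices of `G_n^4` as optional elements of `{0, …, 2n}`. -/
def G4Vertex.equivOption (n : ℕ) : G4Vertex n ≃ Option (Option (Fin (2 * n + 1))) where
  toFun
    | .num i h h' => some (some ⟨i - 1, by omega⟩)
    | .x => some none
    | .y => none
  invFun
    | some (some i) => .num (i + 1) (by omega) (by omega)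
    | some none => .x
    | none => .y
  left_inv v := by
    rcases v with ⟨i, h, h'⟩ | _ | _
    · simp; omega
    · rfl
    · rfl
  right_inv v := by
    rcases v with _ | _ | i
    · rfl
    · rfl
    · simp

theorem G4Vertex.natCard (n : ℕ) : Nat.card (G4Vertex n) = 2 * n + 3 := by
  rw [Nat.card_congr (G4Vertex.equivOption n)]
  simp

instance G4Vertex.instFinite (n : ℕ) : Finite (G4Vertex n) :=
  Finite.of_equiv _ (G4Vertex.equivOption n).symm

section Adjacency

variable {n : ℕ}

theorem G4_adj_num_num {i j : ℕ} {hi : 1 ≤ i} {hi' : i ≤ 2 * n + 1} {hj : 1 ≤ j}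
    {hj' : j ≤ 2 * n + 1} : (G4 n).Adj (.num i hi hi') (.num j hj hj') ↔
      i ≠ j ∧ (i = 1 ∨ j = 1 ∨ i = 2 * n + 1 ∨ j = 2 * n + 1 ∨ j = i + 1 ∨ i = j + 1) := by
  simp only [G4, SimpleGraph.fromRel_adj, G4Rel, ne_eq, G4Vertex.num.injEq]
  omega

theorem G4_adj_x_num {j : ℕ} {hj : 1 ≤ j} {hj' : j ≤ 2 * n + 1} :
    (G4 n).Adj .x (.num j hj hj') ↔ j = 1 ∨ j = 2 * n := by
  simp [G4, G4Rel]

theorem G4_adj_num_x {j : ℕ} {hj : 1 ≤ j} {hj' : j ≤ 2 * n + 1} :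
    (G4 n).Adj (.num j hj hj') .x ↔ j = 1 ∨ j = 2 * n := by
  simp [G4, G4Rel]

theorem G4_adj_y_num {j : ℕ} {hj : 1 ≤ j} {hj' : j ≤ 2 * n + 1} :
    (G4 n).Adj .y (.num j hj hj') ↔ j = 2 ∨ j = 2 * n + 1 := by
  simp [G4, G4Rel]

theorem G4_adj_num_y {j : ℕ} {hj : 1 ≤ j} {hj' : j ≤ 2 * n + 1} :
    (G4 n).Adj (.num j hj hj') .y ↔ j = 2 ∨ j = 2 * n + 1 := by
  simp [G4, G4Rel]

theorem G4_not_adj_x_y : ¬ (G4 n).Adj .x .y := by simp [G4, G4Rel]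

theorem G4_not_adj_y_x : ¬ (G4 n).Adj .y .x := by simp [G4, G4Rel]

end Adjacency

/-! ### Proper induced subgraphs -/

/-- Ranks orienting `G_n^4` transitively once the vertex `1` is deleted. -/
def G4.rankWithoutFirst (n : ℕ) : G4Vertex n → ℕ
  | .num i _ _ => if i = 2 * n + 1 then 0 else if i % 2 = 1 then 1 else 2
  | .x => 0
  | .y => 1

/-- Ranks orienting `G_n^4` transitively once the vertex `2n+1` is deleted. -/
def G4.rankWithoutLast (n : ℕ) : G4Vertex n → ℕ
  | .num i _ _ => if i = 1 then 0 else if i % 2 = 1 then 1 else 2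
  | .x => 1
  | .y => 0

/-- Ranks orienting `G_n^4` transitively once the vertex `k` of the path `2, …, 2n` is deleted;
for `k = 1` and `k = 2n+1` they do so when `y`, respectively `x`, is deleted. -/
def G4.rankSplit (n k : ℕ) : G4Vertex n → ℕ
  | .num i _ _ => if i = 1 then 0 else if i = 2 * n + 1 then 3 else
      -- If present, 2 must be a local maximum of the path, being above `y`, and 2n a local minimum,
      -- being below `x`. The parity switch at `k` allows both.
      if (i < k ∧ i % 2 = 1) ∨ (k < i ∧ i % 2 = 0) then 1 else 2
  | .x => 3
  | .y => 0

theorem G4_induce_without_first {n : ℕ} (hn : 3 ≤ n) {s : Set (G4Vertex n)}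
    (hs : G4Vertex.num 1 le_rfl (by omega) ∉ s) : WordRepresentable ((G4 n).induce s) := by
  refine wordRepresentable_induce_of_rank _ _ (G4.rankWithoutFirst n) ?_ ?_ hs
  · rintro (⟨i, hi, hi'⟩ | _ | _) (⟨j, hj, hj'⟩ | _ | _) <;>
    simp only [G4.rankWithoutFirst, G4_adj_num_num, G4_adj_x_num, G4_adj_num_x, G4_adj_y_num,
      G4_adj_num_y, G4_not_adj_x_y, G4_not_adj_y_x, SimpleGraph.irrefl, ne_eq, G4Vertex.num.injEq,
      reduceCtorEq] <;> grind
  · rintro (⟨i, hi, hi'⟩ | _ | _) (⟨j, hj, hj'⟩ | _ | _) (⟨k, hk, hk'⟩ | _ | _) <;>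
    simp only [G4.rankWithoutFirst, G4_adj_num_num, G4_adj_x_num, G4_adj_num_x, G4_adj_y_num,
      G4_adj_num_y, G4_not_adj_x_y, G4_not_adj_y_x, SimpleGraph.irrefl, ne_eq, G4Vertex.num.injEq,
      reduceCtorEq] <;> grind

theorem G4_induce_without_last {n : ℕ} (hn : 3 ≤ n) {s : Set (G4Vertex n)}
    (hs : G4Vertex.num (2 * n + 1) (by omega) le_rfl ∉ s) :
    WordRepresentable ((G4 n).induce s) := by
  refine wordRepresentable_induce_of_rank _ _ (G4.rankWithoutLast n) ?_ ?_ hs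
  · rintro (⟨i, hi, hi'⟩ | _ | _) (⟨j, hj, hj'⟩ | _ | _) <;>
    simp only [G4.rankWithoutLast, G4_adj_num_num, G4_adj_x_num, G4_adj_num_x, G4_adj_y_num,
      G4_adj_num_y, G4_not_adj_x_y, G4_not_adj_y_x, SimpleGraph.irrefl, ne_eq, G4Vertex.num.injEq,
      reduceCtorEq] <;> grind
  · rintro (⟨i, hi, hi'⟩ | _ | _) (⟨j, hj, hj'⟩ | _ | _) (⟨k, hk, hk'⟩ | _ | _) <;>
    simp only [G4.rankWithoutLast, G4_adj_num_num, G4_adj_x_num, G4_adj_num_x, G4_adj_y_num,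
      G4_adj_num_y, G4_not_adj_x_y, G4_not_adj_y_x, SimpleGraph.irrefl, ne_eq, G4Vertex.num.injEq,
      reduceCtorEq] <;> grind

theorem G4_induce_split {n : ℕ} (hn : 3 ≤ n) {m : ℕ} {v : G4Vertex n}
    (hv : (∃ h h', v = .num m h h' ∧ 2 ≤ m ∧ m ≤ 2 * n) ∨ (v = .y ∧ m = 1) ∨
      (v = .x ∧ m = 2 * n + 1))
    {s : Set (G4Vertex n)} (hs : v ∉ s) : WordRepresentable ((G4 n).induce s) := by
  refine wordRepresentable_induce_of_rank _ _ (G4.rankSplit n m) ?_ ?_ hs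
  · rintro (⟨i, hi, hi'⟩ | _ | _) (⟨j, hj, hj'⟩ | _ | _) <;>
    rcases hv with ⟨_, _, rfl, _, _⟩ | ⟨rfl, rfl⟩ | ⟨rfl, rfl⟩ <;>
    simp only [G4.rankSplit, G4_adj_num_num, G4_adj_x_num, G4_adj_num_x, G4_adj_y_num,
      G4_adj_num_y, G4_not_adj_x_y, G4_not_adj_y_x, SimpleGraph.irrefl, ne_eq, G4Vertex.num.injEq,
      reduceCtorEq] <;> grind
  · rintro (⟨i, hi, hi'⟩ | _ | _) (⟨j, hj, hj'⟩ | _ | _) (⟨k, hk, hk'⟩ | _ | _) <;>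
    rcases hv with ⟨_, _, rfl, _, _⟩ | ⟨rfl, rfl⟩ | ⟨rfl, rfl⟩ <;>
    simp only [G4.rankSplit, G4_adj_num_num, G4_adj_x_num, G4_adj_num_x, G4_adj_y_num,
      G4_adj_num_y, G4_not_adj_x_y, G4_not_adj_y_x, SimpleGraph.irrefl, ne_eq, G4Vertex.num.injEq,
      reduceCtorEq] <;> grind

theorem G4_induce_wordRepresentable {n : ℕ} (hn : 3 ≤ n) {s : Set (G4Vertex n)}
    (hs : s ≠ Set.univ) : WordRepresentable ((G4 n).induce s) := by
  obtain ⟨v, hv⟩ := (Set.ne_univ_iff_exists_notMem s).1 hs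
  rcases v with ⟨i, h, h'⟩ | _ | _
  · by_cases h1 : i = 1
    · subst h1
      exact G4_induce_without_first hn hv
    by_cases h2 : i = 2 * n + 1
    · subst h2
      exact G4_induce_without_last hn hv
    exact G4_induce_split hn (Or.inl ⟨h, h', rfl, by omega, by omega⟩) hv
  · exact G4_induce_split hn (Or.inr (Or.inr ⟨rfl, rfl⟩)) hv
  · exact G4_induce_split hn (Or.inr (Or.inl ⟨rfl, rfl⟩)) hv

/-! ### Closeness of integer functions and non-representability -/

/-- One of the functions `u`, `v` is between the other one and the other one plus one. -/
def Close {ι : Type*} (u v : ι → ℤ) : Prop :=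
  (∀ t, v t ≤ u t ∧ u t ≤ v t + 1) ∨ (∀ t, u t ≤ v t ∧ v t ≤ u t + 1)

theorem Close.symm {ι : Type*} {u v : ι → ℤ} (h : Close u v) : Close v u := Or.symm h

theorem close_neg {ι : Type*} {u v : ι → ℤ} : Close (-u) (-v) ↔ Close u v := by
  have key : ∀ {u v : ι → ℤ}, Close u v → Close (-u) (-v) := by
    rintro u v (h | h)
    · refine Or.inr fun t => ?_
      have := h t
      simp only [Pi.neg_apply]
      omega
    · refine Or.inl fun t => ?_
      have := h t
      simp only [Pi.neg_apply]
      omega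
  exact ⟨fun h => by simpa using key h, key⟩

/-- Occurrence counts of the letters of a representing word, in its prefixes. -/
theorem Represents.adj_iff_close {V : Type*} [DecidableEq V] {w : List V} {G : SimpleGraph V}
    (h : Represents w G) {i j : V} (hij : i ≠ j) :
    G.Adj i j ↔ Close (fun t => ((w.take t).count i : ℤ)) (fun t => ((w.take t).count j : ℤ)) := by
  rw [h i j hij, alternate_iff_leads w hij, Close]
  refine or_congr (forall_congr' fun t => ?_) (forall_congr' fun t => ?_) <;> omega

/-- Two consecutive steps in the same direction would make `p i` and `p (i + 2)` comparable. The
number 2n-2 of steps is even, so the last goes down if the first goes up. -/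
theorem le_last_of_zigzag {α : Type*} [Preorder α] {n : ℕ} (hn : 2 ≤ n) (p : ℕ → α)
    (hc : ∀ i, 2 ≤ i → i + 1 ≤ 2 * n → p i ≤ p (i + 1) ∨ p (i + 1) ≤ p i)
    (hi : ∀ i, 2 ≤ i → i + 2 ≤ 2 * n → ¬ p i ≤ p (i + 2) ∧ ¬ p (i + 2) ≤ p i)
    (h0 : ¬ p 3 ≤ p 2) : p (2 * n) ≤ p (2 * n - 1) := by
  have down : ∀ i, 2 ≤ i → i + 2 ≤ 2 * n → p i ≤ p (i + 1) → p (i + 2) ≤ p (i + 1) :=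
    fun i h2 hin h => (hc (i + 1) (by omega) (by omega)).resolve_left
      fun h' => (hi i h2 hin).1 (h.trans h')
  have up : ∀ i, 2 ≤ i → i + 2 ≤ 2 * n → p (i + 1) ≤ p i → p (i + 1) ≤ p (i + 2) :=
    fun i h2 hin h => (hc (i + 1) (by omega) (by omega)).resolve_right
      fun h' => (hi i h2 hin).2 (h'.trans h)
  have key : ∀ k, 2 * k + 4 ≤ 2 * n → p (2 * k + 2) ≤ p (2 * k + 3) := by
    intro k
    induction k with
    | zero => exact fun _ => (hc 2 le_rfl (by omega)).resolve_right h0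
    | succ k ih =>
      intro hk
      exact up (2 * k + 3) (by omega) (by omega)
        (down (2 * k + 2) (by omega) (by omega) (ih (by omega)))
  obtain ⟨k, rfl⟩ : ∃ k, n = k + 2 := ⟨n - 2, by omega⟩
  exact down (2 * k + 2) (by omega) (by omega) (key k (by omega))

section EndOfPath

variable {ι : Type*} {a b x p q : ι → ℤ}

/-- If p ≤ q, then each choice of sides for `x` against `a` and `p` squeezes `x` into closeness to
`b` or `q`. -/
theorem not_le_of_between (hba : ∀ t, b t ≤ a t ∧ a t ≤ b t + 1)
    (hp : ∀ t, b t ≤ p t ∧ p t ≤ a t) (hq : ∀ t, b t ≤ q t ∧ q t ≤ a t)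
    (hxa : Close x a) (hxp : Close x p) (hxb : ¬ Close x b) (hxq : ¬ Close x q) :
    ¬ p ≤ q := by
  intro hpq
  rcases hxa with h1 | h1 <;> rcases hxp with h2 | h2 <;>
  first
  | (refine hxb (Or.inl fun t => ?_)
     have := hba t; have := hp t; have := hq t; have := h1 t; have := h2 t; have : p t ≤ q t := hpq t; omega)
  | (refine hxb (Or.inr fun t => ?_)
     have := hba t; have := hp t; have := hq t; have := h1 t; have := h2 t; have : p t ≤ q t := hpq t; omega)
  | (refine hxq (Or.inl fun t => ?_)
     have := hba t; have := hp t; have := hq t; have := h1 t; have := h2 t; have : p t ≤ q t := hpq t; omega)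
  | (refine hxq (Or.inr fun t => ?_)
     have := hba t; have := hp t; have := hq t; have := h1 t; have := h2 t; have : p t ≤ q t := hpq t; omega)

/-- `g` is `p - 1` with `p` between `a` and `b + 1`, or `p` between `a - 1` and `b`. -/
def IsOuter (a b p g : ι → ℤ) : Prop :=
  (∀ t, g t = p t - 1 ∧ a t ≤ p t ∧ p t ≤ b t + 1) ∨
    (∀ t, g t = p t ∧ a t - 1 ≤ p t ∧ p t ≤ b t)

/-- Negation exchanges upper and lower outer functions, which moves the shift by one to the other
case. -/
theorem IsOuter.neg {g : ι → ℤ} (h : IsOuter a b p g) :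
    IsOuter (-b) (-a) (-p) (fun t => - g t - 1) := by
  rcases h with h | h
  · refine Or.inr fun t => ?_
    have := h t
    simp only [Pi.neg_apply]
    omega
  · refine Or.inl fun t => ?_
    have := h t
    simp only [Pi.neg_apply]
    omega

/-- The shift brings all outer functions into the band from a-1 to b, of width at most one. The
common zero at `t₀` excludes the one order between an upper and a lower function that closeness does
not allow. -/
theorem IsOuter.close_iff {g g' : ι → ℤ} {t₀ : ι} (hp₀ : p t₀ = 0) (hq₀ : q t₀ = 0)
    (hba : ∀ t, b t ≤ a t ∧ a t ≤ b t + 1)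
    (hp : IsOuter a b p g) (hq : IsOuter a b q g') : Close p q ↔ g ≤ g' ∨ g' ≤ g := by
  constructor
  · intro h
    rcases hp with hp | hp <;> rcases hq with hq | hq <;> rcases h with h | h <;>
    first
    | (refine Or.inl fun t => ?_
       change g t ≤ g' t
       have := hp t; have := hq t; have := h t; have := hba t; omega)
    | (refine Or.inr fun t => ?_
       change g' t ≤ g t
       have := hp t; have := hq t; have := h t; have := hba t; omega)
  · rintro (h | h)
    · have h : ∀ t, g t ≤ g' t := h
      rcases hp with hp | hp <;> rcases hq with hq | hq
      · exact Or.inr fun t => by have := hp t; have := hq t; have := h t; have := hba t; omega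
      · exact Or.inl fun t => by have := hp t; have := hq t; have := h t; have := hba t; omega
      · have := hp t₀; have := hq t₀; have := h t₀; omega
      · exact Or.inr fun t => by have := hp t; have := hq t; have := h t; have := hba t; omega
    · have h : ∀ t, g' t ≤ g t := h
      rcases hp with hp | hp <;> rcases hq with hq | hq
      · exact Or.inl fun t => by have := hp t; have := hq t; have := h t; have := hba t; omega
      · have := hp t₀; have := hq t₀; have := h t₀; omega
      · exact Or.inr fun t => by have := hp t; have := hq t; have := h t; have := hba t; omega
      · exact Or.inl fun t => by have := hp t; have := hq t; have := h t; have := hba t; omega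

theorem IsOuter.not_le {g g' : ι → ℤ} {t₀ : ι} (hp₀ : p t₀ = 0) (hq₀ : q t₀ = 0)
    (hba : ∀ t, b t ≤ a t ∧ a t ≤ b t + 1)
    (hp : IsOuter a b p g) (hq : IsOuter a b q g')
    (hxa : Close x a) (hxp : Close x p) (hxb : ¬ Close x b) (hxq : ¬ Close x q) :
    ¬ g' ≤ g := by
  intro h
  rcases hp with hp | hp <;> rcases hq with hq | hq <;>
  rcases hxa with h1 | h1 <;> rcases hxp with h2 | h2 <;>
  first
  | (refine hxb (Or.inl fun t => ?_)
     have := hba t; have := hp t; have := hq t; have := h1 t; have := h2 t; have : g' t ≤ g t := h t; omega)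
  | (refine hxb (Or.inr fun t => ?_)
     have := hba t; have := hp t; have := hq t; have := h1 t; have := h2 t; have : g' t ≤ g t := h t; omega)
  | (refine hxq (Or.inl fun t => ?_)
     have := hba t; have := hp t; have := hq t; have := h1 t; have := h2 t; have : g' t ≤ g t := h t; omega)
  | (refine hxq (Or.inr fun t => ?_)
     have := hba t; have := hp t; have := hq t; have := h1 t; have := h2 t; have : g' t ≤ g t := h t; omega)
  | (exfalso
     have := hp t₀; have := hq t₀; have : g' t₀ ≤ g t₀ := h t₀; omega)

/-- A function on the same side of `a` and `b` is outer; otherwise it is squeezed between them. -/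
theorem between_or_isOuter (hba : ∀ t, b t ≤ a t ∧ a t ≤ b t + 1) (hpa : Close p a)
    (hpb : Close p b) : (∀ t, b t ≤ p t ∧ p t ≤ a t) ∨ ∃ g, IsOuter a b p g := by
  rcases hpa with h1 | h1 <;> rcases hpb with h2 | h2
  · exact Or.inr ⟨fun t => p t - 1, Or.inl fun t => ⟨rfl, (h1 t).1, (h2 t).2⟩⟩
  · exact Or.inl fun t => by have := hba t; have := h1 t; have := h2 t; omega
  · exact Or.inl fun t => ⟨(h2 t).1, (h1 t).1⟩
  · exact Or.inr ⟨p, Or.inr fun t => ⟨rfl, by have := h1 t; omega, (h2 t).1⟩⟩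

theorem IsOuter.close_of_between {g : ι → ℤ} (hba : ∀ t, b t ≤ a t ∧ a t ≤ b t + 1)
    (hp : IsOuter a b p g) (hq : ∀ t, b t ≤ q t ∧ q t ≤ a t) : Close p q := by
  rcases hp with hp | hp
  · exact Or.inl fun t => by have := hba t; have := hp t; have := hq t; omega
  · exact Or.inr fun t => by have := hba t; have := hp t; have := hq t; omega

end EndOfPath

theorem not_close_system {ι : Type*} {n : ℕ} (hn : 3 ≤ n) (p : ℕ → ι → ℤ) (a b x y : ι → ℤ)
    (t₀ : ι) (hp₀ : ∀ i, p i t₀ = 0)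
    (hp : ∀ i j, 2 ≤ i → i < j → j ≤ 2 * n → (Close (p i) (p j) ↔ j = i + 1))
    (hba : ∀ t, b t ≤ a t ∧ a t ≤ b t + 1)
    (hpa : ∀ i, 2 ≤ i → i ≤ 2 * n → Close (p i) a)
    (hpb : ∀ i, 2 ≤ i → i ≤ 2 * n → Close (p i) b)
    (hxa : Close x a) (hxp : Close x (p (2 * n))) (hxb : ¬ Close x b)
    (hxq : ¬ Close x (p (2 * n - 1)))
    (hyb : Close y b) (hyp : Close y (p 2)) (hya : ¬ Close y a) (hyq : ¬ Close y (p 3)) :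
    False := by
  -- Negation exchanges `a` and `b`, so the lemmas about `x` also serve for `y`.
  have hba' : ∀ t, (-a) t ≤ (-b) t ∧ (-b) t ≤ (-a) t + 1 := fun t => by
    have := hba t; simp only [Pi.neg_apply]; omega
  rw [← close_neg] at hyb hyp hya hyq
  by_cases hM : ∀ i, 2 ≤ i → i ≤ 2 * n → ∀ t, b t ≤ p i t ∧ p i t ≤ a t
  · have hM' : ∀ i, 2 ≤ i → i ≤ 2 * n → ∀ t, (-a) t ≤ (-p i) t ∧ (-p i) t ≤ (-b) t := by
      intro i h h' t
      have := hM i h h' t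
      simp only [Pi.neg_apply]
      omega
    have hx := not_le_of_between hba (hM (2 * n) (by omega) le_rfl)
      (hM (2 * n - 1) (by omega) (by omega)) hxa hxp hxb hxq
    have hy := not_le_of_between hba' (hM' 2 le_rfl (by omega)) (hM' 3 (by omega) (by omega))
      hyb hyp hya hyq
    rw [neg_le_neg_iff] at hy
    have hcomp : ∀ i j, 2 ≤ i → i ≤ 2 * n → 2 ≤ j → j ≤ 2 * n → p i ≤ p j →
        Close (p i) (p j) := by
      intro i j hi hi' hj hj' h
      refine Or.inr fun t => ?_
      have := hM i hi hi' t
      have := hM j hj hj' t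
      have := hba t
      have : p i t ≤ p j t := h t
      omega
    refine hx (le_last_of_zigzag (by omega) p ?_ ?_ hy)
    · intro i h2 hi
      rcases (hp i (i + 1) h2 (by omega) hi).2 rfl with h | h
      · exact Or.inr fun t => (h t).1
      · exact Or.inl fun t => (h t).1
    · intro i h2 hi
      have hnot : ¬ Close (p i) (p (i + 2)) := by
        rw [hp i (i + 2) h2 (by omega) hi]; omega
      exact ⟨fun h => hnot (hcomp i (i + 2) (by omega) (by omega) (by omega) hi h),
        fun h => hnot (hcomp (i + 2) i (by omega) (by omega) (by omega) (by omega) h).symm⟩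
  · have hfar : ∀ i j, 2 ≤ i → i + 2 ≤ j → j ≤ 2 * n →
        ((∀ t, b t ≤ p i t ∧ p i t ≤ a t) ↔ (∀ t, b t ≤ p j t ∧ p j t ≤ a t)) := by
      intro i j hi hij hj
      have hnot : ¬ Close (p i) (p j) := by rw [hp i j hi (by omega) hj]; omega
      constructor
      · intro h
        refine (between_or_isOuter hba (hpa j (by omega) hj) (hpb j (by omega) hj)).resolve_right ?_
        rintro ⟨g, hg⟩
        exact hnot (hg.close_of_between hba h).symm
      · intro h
        refine (between_or_isOuter hba (hpa i hi (by omega)) (hpb i hi (by omega))).resolve_right ?_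
        rintro ⟨g, hg⟩
        exact hnot (hg.close_of_between hba h)
    have hO : ∀ i, ∃ g, 2 ≤ i → i ≤ 2 * n → IsOuter a b (p i) g := by
      intro i
      by_cases hi : 2 ≤ i ∧ i ≤ 2 * n
      · refine ((between_or_isOuter hba (hpa i hi.1 hi.2) (hpb i hi.1 hi.2)).resolve_left
          fun h => hM ?_).imp fun g hg _ _ => hg
        -- Nonadjacent path vertices are of the same kind; 5 links 2 with 3, which needs 5 ≤ 2n.
        have h25 := hfar 2 5 le_rfl (by omega) (by omega)
        have h35 := hfar 3 5 (by omega) (by omega) (by omega)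
        have h2 : ∀ j, 2 ≤ j → j ≤ 2 * n → ((∀ t, b t ≤ p j t ∧ p j t ≤ a t) ↔
            (∀ t, b t ≤ p 2 t ∧ p 2 t ≤ a t)) := by
          intro j hj hj'
          obtain rfl | rfl | h4 : j = 2 ∨ j = 3 ∨ 4 ≤ j := by omega
          · rfl
          · exact h35.trans h25.symm
          · exact (hfar 2 j le_rfl h4 hj').symm
        exact fun j hj hj' => (h2 j hj hj').2 ((h2 i hi.1 hi.2).1 h)
      · exact ⟨0, fun h h' => absurd ⟨h, h'⟩ hi⟩
    choose g hg using hO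
    have hx := IsOuter.not_le (hp₀ _) (hp₀ _) hba (hg (2 * n) (by omega) le_rfl)
      (hg (2 * n - 1) (by omega) (by omega)) hxa hxp hxb hxq
    have hy := IsOuter.not_le (t₀ := t₀) (by simp [hp₀]) (by simp [hp₀]) hba'
      (hg 2 le_rfl (by omega)).neg (hg 3 (by omega) (by omega)).neg hyb hyp hya hyq
    have hcomp : ∀ i j, 2 ≤ i → i < j → j ≤ 2 * n → (g i ≤ g j ∨ g j ≤ g i ↔ j = i + 1) := by
      intro i j hi hij hj
      rw [← hp i j hi hij hj, IsOuter.close_iff (hp₀ i) (hp₀ j) hba (hg i hi (by omega))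
        (hg j (by omega) hj)]
    -- For outer functions both end conditions are reversed, hence the zigzag of `-g`.
    refine hx (neg_le_neg_iff.1 (le_last_of_zigzag (by omega) (fun i => - g i) ?_ ?_ ?_))
    · intro i h2 hi
      simp only [neg_le_neg_iff]
      exact ((hcomp i (i + 1) h2 (by omega) hi).2 rfl).symm
    · intro i h2 hi
      have := hcomp i (i + 2) h2 (by omega) hi
      simp only [neg_le_neg_iff]
      constructor <;> intro h <;> simp [h] at this
    · intro h
      refine hy fun t => ?_
      have : - g 3 t ≤ - g 2 t := h t
      change - g 3 t - 1 ≤ - g 2 t - 1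
      omega

theorem G4_not_wordRepresentable {n : ℕ} (hn : 3 ≤ n) : ¬ WordRepresentable (G4 n) := by
  rintro ⟨w, hw⟩
  set f : G4Vertex n → ℕ → ℤ := fun v t => ((w.take t).count v : ℤ) with hf
  have hadj : ∀ u v, u ≠ v → ((G4 n).Adj u v ↔ Close (f u) (f v)) :=
    fun u v huv => hw.adj_iff_close huv
  have hf₀ : ∀ v, f v 0 = 0 := fun v => by simp [hf]
  clear_value f
  -- Stated for arbitrary integer functions rather than counts, so that it applies to `-f` when 2n+1
  -- leads 1.
  have main : ∀ f : G4Vertex n → ℕ → ℤ,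
      (∀ u v, u ≠ v → ((G4 n).Adj u v ↔ Close (f u) (f v))) → (∀ v, f v 0 = 0) →
      ¬ ∀ t, f (.num (2 * n + 1) (by omega) le_rfl) t ≤ f (.num 1 le_rfl (by omega)) t ∧
        f (.num 1 le_rfl (by omega)) t ≤ f (.num (2 * n + 1) (by omega) le_rfl) t + 1 := by
    intro f hadj hf₀ hba
    set p : ℕ → ℕ → ℤ := fun i =>
      if h : 1 ≤ i ∧ i ≤ 2 * n + 1 then f (.num i h.1 h.2) else 0 with hpdef
    have hpi : ∀ i (h : 1 ≤ i) (h' : i ≤ 2 * n + 1), p i = f (.num i h h') := fun i h h' => by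
      simp [hpdef, h, h']
    refine not_close_system hn p _ _ (f .x) (f .y) 0 ?_ ?_ hba ?_ ?_ ?_ ?_ ?_ ?_ ?_ ?_ ?_ ?_
    · intro i
      simp only [hpdef]
      split_ifs
      · exact hf₀ _
      · rfl
    · intro i j hi hij hj
      rw [hpi i (by omega) (by omega), hpi j (by omega) (by omega),
        ← hadj _ _ (by simp; omega), G4_adj_num_num]
      omega
    · intro i hi hi'
      rw [hpi i (by omega) (by omega), ← hadj _ _ (by simp; omega), G4_adj_num_num]
      omega
    · intro i hi hi'
      rw [hpi i (by omega) (by omega), ← hadj _ _ (by simp; omega), G4_adj_num_num]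
      omega
    · rw [← hadj _ _ (by simp), G4_adj_x_num]
      omega
    · rw [hpi _ (by omega) (by omega), ← hadj _ _ (by simp), G4_adj_x_num]
      omega
    · rw [← hadj _ _ (by simp), G4_adj_x_num]
      omega
    · rw [hpi _ (by omega) (by omega), ← hadj _ _ (by simp), G4_adj_x_num]
      omega
    · rw [← hadj _ _ (by simp), G4_adj_y_num]
      omega
    · rw [hpi _ (by omega) (by omega), ← hadj _ _ (by simp), G4_adj_y_num]
      omega
    · rw [← hadj _ _ (by simp), G4_adj_y_num]
      omega
    · rw [hpi _ (by omega) (by omega), ← hadj _ _ (by simp), G4_adj_y_num]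
      omega
  have hab := (hadj (.num 1 le_rfl (by omega)) (.num (2 * n + 1) (by omega) le_rfl)
    (by simp; omega)).1 (G4_adj_num_num.2 (by omega))
  rcases hab with h | h
  · exact main f hadj hf₀ h
  · refine main (fun v => - f v) (fun u v huv => ?_) (fun v => by simp [hf₀]) fun t => ?_
    · rw [hadj u v huv, close_neg]
    · have := h t
      simp only [Pi.neg_apply]
      omega

theorem mainTheorem4 :
    (∀ n : ℕ, 3 ≤ n → MinimalNonWordRepresentable (G4 n)) ∧
      (∀ m n : ℕ, 3 ≤ m → 3 ≤ n → m ≠ n → IsEmpty (G4 m ≃g G4 n)) := by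
  refine ⟨fun n hn => ⟨G4_not_wordRepresentable hn, fun s hs =>
    G4_induce_wordRepresentable hn hs⟩, fun m n _ _ hmn => ⟨fun e => hmn ?_⟩⟩
  have := Nat.card_congr e.toEquiv
  rw [G4Vertex.natCard, G4Vertex.natCard] at this
  omega
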